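/- Let $n$ be a natural number and let $d\in\mathbb{C}$ satisfy $d^2=n$. For a complex matrix $C$ with no zero entry let $C^{(-)}$ denote its entrywise inverse, $(C^{(-)})_{i,j}=1/C_{i,j}$. An $m\times m$ complex matrix $C$ is *type II* if it has no zero entry and $C\,(C^{(-)})^{T}=mI$. For an $m\times m$ complex matrix $C$ let $X_C$ and $\Delta_C$ be the linear operators on $m\times m$ complex matrices given by $X_C(M)=CM$ and $\Delta_C(M)=C\circ M$, where $\circ$ is the entrywise product. A pair $(A,B)$ of $m\times m$ complex matrices is a *one-sided Jones pair* if $X_A\Delta_BX_A=\Delta_BX_A\Delta_B$; it is a *Jones pair* if both $(A,B)$ and $(A,B^T)$ are one-sided Jones pairs, and it is *invertible* if $X_A$ and $\Delta_B$ are invertible operators. A symmetric $m\times m$ matrix $W$ is a *symmetric spin model with loop variable $D$* if $D^2=m$, $W$ is type II, and $$\sum_{x=1}^{m}\frac{W_{a,x}W_{b,x}}{W_{c,x}}=D\,\frac{W_{a,b}}{W_{a,c}W_{b,c}}\qquad\text{for all } a,b,c\in\{1,\dots,m\}.$$ **Theorem.** Let $A$ and $B$ be $n\times n$ type-II matrices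 with $A$ symmetric. Then the $4n\times 4n$ matrix $$V=\begin{pmatrix} dA & -dA & B^{(-)} & B^{(-)}\\ -dA & dA & B^{(-)} & B^{(-)}\\ B^{(-)T} & B^{(-)T} & dA & -dA\\ B^{(-)T} & B^{(-)T} & -dA & dA\end{pmatrix}$$ is a symmetric spin model with loop variable $2d$ if and only if $(A,B)$ is an invertible Jones pair. -/

import Mathlib

namespace JonesPairs

open scoped Matrix

variable {ι : Type*}

/-- The Schur (entrywise) inverse `C^{(-)}` of a complex matrix. It is used only for matrices
with no zero entry. -/
noncomputable def schurInv (C : Matrix ι ι ℂ) : Matrix ι ι ℂ := C.map fun z => z⁻¹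

/-- A square complex matrix of order `n` is type II if it has no zero entry and
`C * (C^{(-)})ᵀ = n • 1`. -/
structure IsTypeII [Fintype ι] [DecidableEq ι] (C : Matrix ι ι ℂ) : Prop where
  ne_zero : ∀ i j, C i j ≠ 0
  mul_schurInv_transpose : C * (schurInv C)ᵀ = (Fintype.card ι : ℂ) • (1 : Matrix ι ι ℂ)

/-- The operator `X_C : M ↦ C * M` on square matrices. -/
def opX [Fintype ι] (C : Matrix ι ι ℂ) : Module.End ℂ (Matrix ι ι ℂ) where
  toFun M := C * M
  map_add' := Matrix.mul_add C
  map_smul' c M := Matrix.mul_smul C c M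

/-- The operator `Δ_C : M ↦ C ∘ M` (Schur, i.e. entrywise, product) on square matrices. -/
def opDelta (C : Matrix ι ι ℂ) : Module.End ℂ (Matrix ι ι ℂ) where
  toFun M := C ⊙ M
  map_add' M N := Matrix.hadamard_add C M N
  map_smul' c M := Matrix.hadamard_smul C M c

/-- `(A, B)` is a one-sided Jones pair: `X_A Δ_B X_A = Δ_B X_A Δ_B`. -/
def IsOneSidedJonesPair [Fintype ι] (A B : Matrix ι ι ℂ) : Prop :=
  opX A * opDelta B * opX A = opDelta B * opX A * opDelta B

/-- `(A, B)` is a Jones pair if both `(A, B)` and `(A, Bᵀ)` are one-sided Jones pairs. -/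
def IsJonesPair [Fintype ι] (A B : Matrix ι ι ℂ) : Prop :=
  IsOneSidedJonesPair A B ∧ IsOneSidedJonesPair A Bᵀ

/-- A Jones pair `(A, B)` is invertible if the operators `X_A` and `Δ_B` are invertible. -/
def IsInvertibleJonesPair [Fintype ι] (A B : Matrix ι ι ℂ) : Prop :=
  IsJonesPair A B ∧ IsUnit (opX A) ∧ IsUnit (opDelta B)

/-- `W` is a symmetric spin model with loop variable `D`: the matrix `W` is symmetric and type II,
`D` is a square root of the order of `W`, and the star-triangle relation holds. -/
structure IsSymmetricSpinModel [Fintype ι] [DecidableEq ι] (W : Matrix ι ι ℂ) (D : ℂ) : Prop where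
  symm : W.IsSymm
  loop_sq : D ^ 2 = (Fintype.card ι : ℂ)
  typeII : IsTypeII W
  star_triangle : ∀ a b c,
    ∑ x, W a x * W b x / W c x = D * (W a b / (W a c * W b c))

/-- The `4n × 4n` matrix
```
  dA        -dA       B^(-)   B^(-)
 -dA         dA       B^(-)   B^(-)
  B^(-)ᵀ     B^(-)ᵀ   dA     -dA
  B^(-)ᵀ     B^(-)ᵀ  -dA      dA
```
-/
noncomputable def matV (d : ℂ) (A B : Matrix ι ι ℂ) :
    Matrix ((ι ⊕ ι) ⊕ (ι ⊕ ι)) ((ι ⊕ ι) ⊕ (ι ⊕ ι)) ℂ :=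
  Matrix.fromBlocks
    (Matrix.fromBlocks (d • A) (-(d • A)) (-(d • A)) (d • A))
    (Matrix.fromBlocks (schurInv B) (schurInv B) (schurInv B) (schurInv B))
    (Matrix.fromBlocks (schurInv B)ᵀ (schurInv B)ᵀ (schurInv B)ᵀ (schurInv B)ᵀ)
    (Matrix.fromBlocks (d • A) (-(d • A)) (-(d • A)) (d • A))

end JonesPairs

/-!
On `M`, the operators `X_A` and `Δ_B` act column by column, so an equality
`X_A Δ_B X_C = Δ_P X_Q Δ_R` is a family of scalar identities indexed by triples. Three equalities
follow from the braid relation: the relation itself, its conjugation form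
`X_A⁻¹ Δ_B X_A = Δ_B X_A Δ_B⁻¹`, and the conjugation form of the inverse pair `(A⁻¹, B^(-))`.
Their scalar forms are exactly the star-triangle relations of `V` for triples with at least two
indices in the first half (one of them after using that `B` is type II); the signs in `V` kill the
contribution of one half of each sum over the index set. Interchanging the two halves replaces
`B` by `Bᵀ`, which accounts for the remaining triples.

For an invertible Jones pair without zero entries, summing the conjugation form shows that `B` has
constant column sums `tr A`, and row sums likewise; summing it over the columns of `B` then makes
`B` type II, and this in turn makes `A` type II. Conversely, the signs in `V` separate the type-II
conditions of `A` and of `B`.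
-/

namespace JonesPairs

open scoped Matrix

section Operators

variable {ι : Type*}

/-- `Δ_B` as a unit of the endomorphism ring, with inverse `Δ_{B^(-)}`. -/
noncomputable def opDeltaUnit (B : Matrix ι ι ℂ) (hB : ∀ i j, B i j ≠ 0) :
    (Module.End ℂ (Matrix ι ι ℂ))ˣ where
  val := opDelta B
  inv := opDelta (schurInv B)
  val_inv := LinearMap.ext fun M => Matrix.ext fun i j => mul_inv_cancel_left₀ (hB i j) (M i j)
  inv_val := LinearMap.ext fun M => Matrix.ext fun i j => inv_mul_cancel_left₀ (hB i j) (M i j)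

variable [Fintype ι]

theorem opX_mul_opDelta_mul_opX_apply (A B C M : Matrix ι ι ℂ) (i k : ι) :
    (opX A * opDelta B * opX C) M i k = ∑ j, (∑ x, A i x * B x k * C x j) * M j k := by
  simp only [Module.End.mul_apply, opX, opDelta, LinearMap.coe_mk, AddHom.coe_mk,
    Matrix.mul_apply, Matrix.hadamard_apply, Finset.mul_sum, Finset.sum_mul]
  rw [Finset.sum_comm]
  simp only [mul_assoc]

theorem opDelta_mul_opX_mul_opDelta_apply (P Q R M : Matrix ι ι ℂ) (i k : ι) :
    (opDelta P * opX Q * opDelta R) M i k = ∑ j, P i k * Q i j * R j k * M j k := by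
  simp only [Module.End.mul_apply, opX, opDelta, LinearMap.coe_mk, AddHom.coe_mk,
    Matrix.mul_apply, Matrix.hadamard_apply, Finset.mul_sum, mul_assoc]

theorem opX_mul_opDelta_mul_opX_eq_iff {A B C P Q R : Matrix ι ι ℂ} :
    opX A * opDelta B * opX C = opDelta P * opX Q * opDelta R ↔
      ∀ i j k, ∑ x, A i x * B x k * C x j = P i k * Q i j * R j k := by
  classical
  refine ⟨fun h i j k => ?_, fun h => LinearMap.ext fun M => Matrix.ext fun i k => ?_⟩
  · have hij := congrArg (fun T => T (Matrix.single j k 1) i k) h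
    simpa [opX_mul_opDelta_mul_opX_apply, opDelta_mul_opX_mul_opDelta_apply,
      Matrix.single_apply] using hij
  · simp only [opX_mul_opDelta_mul_opX_apply, opDelta_mul_opX_mul_opDelta_apply, h]

theorem isOneSidedJonesPair_iff {A B : Matrix ι ι ℂ} :
    IsOneSidedJonesPair A B ↔
      ∀ i j k, ∑ x, A i x * B x k * A x j = B i k * A i j * B j k :=
  opX_mul_opDelta_mul_opX_eq_iff

variable [DecidableEq ι]

/-- `X_A` as a unit of the endomorphism ring, with inverse `X_{A⁻¹}`. -/
noncomputable def opXUnit (A : Matrix ι ι ℂ) (hA : IsUnit A) :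
    (Module.End ℂ (Matrix ι ι ℂ))ˣ where
  val := opX A
  inv := opX A⁻¹
  val_inv := LinearMap.ext fun M =>
    Matrix.mul_nonsing_inv_cancel_left A M ((Matrix.isUnit_iff_isUnit_det A).mp hA)
  inv_val := LinearMap.ext fun M =>
    Matrix.nonsing_inv_mul_cancel_left A M ((Matrix.isUnit_iff_isUnit_det A).mp hA)

theorem isUnit_opX_iff {A : Matrix ι ι ℂ} : IsUnit (opX A) ↔ IsUnit A := by
  refine ⟨fun ⟨u, hu⟩ => ?_, fun hA => ⟨opXUnit A hA, rfl⟩⟩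
  have hAu : A * (↑u⁻¹ : Module.End ℂ (Matrix ι ι ℂ)) 1 = 1 := by
    have h := LinearMap.congr_fun u.mul_inv 1
    rwa [hu] at h
  exact IsUnit.of_mul_eq_one _ hAu

end Operators

section TypeII

variable {ι : Type*} [Fintype ι] [DecidableEq ι] {C : Matrix ι ι ℂ}

theorem isTypeII_iff_sum_div : IsTypeII C ↔ (∀ i j, C i j ≠ 0) ∧
    ∀ a c, ∑ x, C a x / C c x = if a = c then (Fintype.card ι : ℂ) else 0 := by
  have hentry : C * (schurInv C)ᵀ = (Fintype.card ι : ℂ) • (1 : Matrix ι ι ℂ) ↔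
      ∀ a c, ∑ x, C a x / C c x = if a = c then (Fintype.card ι : ℂ) else 0 := by
    simp [← Matrix.ext_iff, Matrix.mul_apply, schurInv, Matrix.one_apply, div_eq_mul_inv]
  exact ⟨fun h => ⟨h.ne_zero, hentry.mp h.mul_schurInv_transpose⟩,
    fun h => ⟨h.1, hentry.mpr h.2⟩⟩

theorem isTypeII_iff_pairwise : IsTypeII C ↔ (∀ i j, C i j ≠ 0) ∧
    Pairwise fun a c => ∑ x, C a x / C c x = 0 := by
  rw [isTypeII_iff_sum_div]
  refine and_congr_right fun hC => ⟨fun h a c hac => (h a c).trans (if_neg hac), fun h a c => ?_⟩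
  split_ifs with hac
  · subst hac
    simp [hC]
  · exact h hac

namespace IsTypeII

theorem sum_div (hC : IsTypeII C) (a c : ι) :
    ∑ x, C a x / C c x = if a = c then (Fintype.card ι : ℂ) else 0 :=
  (isTypeII_iff_sum_div.mp hC).2 a c

theorem mul_smul_schurInv_transpose [Nonempty ι] (hC : IsTypeII C) :
    C * ((Fintype.card ι : ℂ)⁻¹ • (schurInv C)ᵀ) = 1 := by
  rw [Matrix.mul_smul, hC.mul_schurInv_transpose, inv_smul_smul₀ (by simp)]

theorem inv_apply (hC : IsTypeII C) (i j : ι) :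
    C⁻¹ i j = (Fintype.card ι : ℂ)⁻¹ * (C j i)⁻¹ := by
  have : Nonempty ι := ⟨i⟩
  rw [Matrix.inv_eq_right_inv hC.mul_smul_schurInv_transpose]
  rfl

theorem isUnit (hC : IsTypeII C) : IsUnit C := by
  cases isEmpty_or_nonempty ι
  · exact isUnit_of_subsingleton C
  · exact IsUnit.of_mul_eq_one _ hC.mul_smul_schurInv_transpose

theorem transpose (hC : IsTypeII C) : IsTypeII Cᵀ := by
  refine ⟨fun i j => hC.ne_zero j i, ?_⟩
  cases isEmpty_or_nonempty ι
  · exact Subsingleton.elim _ _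
  have hleft := congrArg Matrix.transpose (mul_eq_one_comm.mp hC.mul_smul_schurInv_transpose)
  rw [Matrix.smul_mul, Matrix.transpose_smul, Matrix.transpose_mul, Matrix.transpose_transpose,
    Matrix.transpose_one, inv_smul_eq_iff₀ (by simp)] at hleft
  exact hleft

end IsTypeII

theorem isTypeII_of_card_mul_inv_mul (hC : IsUnit C)
    (h : ∀ i j, Fintype.card ι * (C⁻¹ i j * C j i) = 1) : IsTypeII C := by
  have hne : ∀ i j, C i j ≠ 0 := fun i j hij => by simpa [hij] using h j i
  have hinv : (schurInv C)ᵀ = (Fintype.card ι : ℂ) • C⁻¹ := Matrix.ext fun i j =>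
    inv_eq_of_mul_eq_one_left <| by
      simpa only [Matrix.smul_apply, smul_eq_mul, mul_assoc] using h i j
  refine ⟨hne, ?_⟩
  rw [hinv, Matrix.mul_smul, Matrix.mul_nonsing_inv _ ((Matrix.isUnit_iff_isUnit_det C).mp hC)]

end TypeII

section JonesPairs

variable {ι : Type*} [Fintype ι] [DecidableEq ι] {A B : Matrix ι ι ℂ}

namespace IsOneSidedJonesPair

theorem inv_schurInv (h : IsOneSidedJonesPair A B) (hA : IsUnit A) (hB : ∀ i j, B i j ≠ 0) :
    IsOneSidedJonesPair A⁻¹ (schurInv B) := by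
  have hbraid : opXUnit A hA * opDeltaUnit B hB * opXUnit A hA =
      opDeltaUnit B hB * opXUnit A hA * opDeltaUnit B hB := Units.ext h
  have hinv := congrArg (·⁻¹) hbraid
  simp only [mul_inv_rev, ← mul_assoc] at hinv
  exact congrArg Units.val hinv

theorem sum_inv_mul_mul (h : IsOneSidedJonesPair A B) (hA : IsUnit A) (hB : ∀ i j, B i j ≠ 0)
    (i j k : ι) : ∑ x, A⁻¹ i x * B x k * A x j = B i k * A i j * (B j k)⁻¹ := by
  have hbraid : opXUnit A hA * opDeltaUnit B hB * opXUnit A hA =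
      opDeltaUnit B hB * opXUnit A hA * opDeltaUnit B hB := Units.ext h
  have hconj : (opXUnit A hA)⁻¹ * opDeltaUnit B hB * opXUnit A hA =
      opDeltaUnit B hB * opXUnit A hA * (opDeltaUnit B hB)⁻¹ := by
    rw [eq_mul_inv_iff_mul_eq, mul_assoc, mul_assoc, inv_mul_eq_iff_eq_mul, ← mul_assoc, ← hbraid,
      mul_assoc]
  exact opX_mul_opDelta_mul_opX_eq_iff.mp (congrArg Units.val hconj) i j k

theorem sum_col_eq_trace (h : IsOneSidedJonesPair A B) (hA : IsUnit A) (hB : ∀ i j, B i j ≠ 0)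
    (k : ι) : ∑ x, B x k = A.trace := by
  have hAA : A * A⁻¹ = 1 := Matrix.mul_nonsing_inv A ((Matrix.isUnit_iff_isUnit_det A).mp hA)
  calc ∑ x, B x k = ∑ x, B x k * (A * A⁻¹) x x := by simp [hAA]
    _ = ∑ i, ∑ x, A⁻¹ i x * B x k * A x i := by
        rw [Finset.sum_comm]
        simp only [Matrix.mul_apply, Finset.mul_sum]
        exact Finset.sum_congr rfl fun x _ => Finset.sum_congr rfl fun i _ => by ring
    _ = ∑ i, A i i := Finset.sum_congr rfl fun i _ => by
        rw [h.sum_inv_mul_mul hA hB]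
        field_simp [hB i k]

end IsOneSidedJonesPair

namespace IsJonesPair

theorem isTypeII_right (h : IsJonesPair A B) (hA : IsUnit A) (hA₀ : Pairwise fun i j => A i j ≠ 0)
    (hB : ∀ i j, B i j ≠ 0) : IsTypeII B := by
  refine isTypeII_iff_pairwise.mpr ⟨hB, fun i j hij => ?_⟩
  have hrow (x : ι) : ∑ k, B x k = A.trace := h.2.sum_col_eq_trace hA (fun i j => hB j i) x
  have hAA : A⁻¹ * A = 1 := Matrix.nonsing_inv_mul A ((Matrix.isUnit_iff_isUnit_det A).mp hA)
  refine (mul_eq_zero_iff_left (hA₀ hij)).mp ?_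
  calc A i j * ∑ k, B i k / B j k = ∑ k, ∑ x, A⁻¹ i x * B x k * A x j := by
        rw [Finset.mul_sum]
        refine Finset.sum_congr rfl fun k _ => ?_
        rw [h.1.sum_inv_mul_mul hA hB]
        ring
    _ = (∑ x, A⁻¹ i x * A x j) * A.trace := by
        rw [Finset.sum_comm, Finset.sum_mul]
        refine Finset.sum_congr rfl fun x _ => ?_
        rw [← hrow x, Finset.mul_sum]
        exact Finset.sum_congr rfl fun k _ => by ring
    _ = 0 := by rw [← Matrix.mul_apply, hAA, Matrix.one_apply_ne hij, zero_mul]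

theorem isTypeII_left (h : IsJonesPair A B) (hA : IsUnit A) (hB : IsTypeII B) : IsTypeII A := by
  have hrow (y : ι) : ∑ k, (B y k)⁻¹ = A⁻¹.trace :=
    (h.2.inv_schurInv hA fun i j => hB.ne_zero j i).sum_col_eq_trace
      (Matrix.isUnit_nonsing_inv_iff.mpr hA) (fun i j => inv_ne_zero (hB.ne_zero j i)) y
  have hconst (i y : ι) : Fintype.card ι * (A⁻¹ i y * A y i) = A i i * A⁻¹.trace := by
    have hsum (k : ι) : ∑ x, A⁻¹ i x * A x i * B x k = A i i := by
      have hk := h.1.sum_inv_mul_mul hA hB.ne_zero i i k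
      rw [mul_right_comm, mul_inv_cancel₀ (hB.ne_zero i k), one_mul] at hk
      simpa only [mul_right_comm] using hk
    calc Fintype.card ι * (A⁻¹ i y * A y i)
        = ∑ x, A⁻¹ i x * A x i * ∑ k, B x k / B y k := by
          simp [hB.sum_div, mul_comm]
      _ = ∑ k, (∑ x, A⁻¹ i x * A x i * B x k) * (B y k)⁻¹ := by
          simp only [Finset.mul_sum, Finset.sum_mul, div_eq_mul_inv, mul_assoc]
          exact Finset.sum_comm
      _ = A i i * A⁻¹.trace := by simp only [hsum, ← Finset.mul_sum, hrow]
  refine isTypeII_of_card_mul_inv_mul hA fun i j => ?_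
  have hcard : (Fintype.card ι : ℂ) ≠ 0 := by
    have : Nonempty ι := ⟨i⟩
    simp
  have hAA : A⁻¹ * A = 1 := Matrix.nonsing_inv_mul A ((Matrix.isUnit_iff_isUnit_det A).mp hA)
  rw [hconst]
  refine mul_left_cancel₀ hcard ?_
  calc Fintype.card ι * (A i i * A⁻¹.trace)
      = ∑ y, Fintype.card ι * (A⁻¹ i y * A y i) := by simp [hconst]
    _ = Fintype.card ι * 1 := by
        rw [← Finset.mul_sum, ← Matrix.mul_apply, hAA, Matrix.one_apply_eq]

end IsJonesPair

theorem IsOneSidedJonesPair.sum_div_mul (h : IsOneSidedJonesPair A B) (hA : IsTypeII A)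
    (hB : ∀ i j, B i j ≠ 0) (a b c : ι) :
    ∑ x, A a x / (A c x * B x b) = B c b / (B a b * A c a) := by
  have hcard : (Fintype.card ι : ℂ) ≠ 0 := by
    have : Nonempty ι := ⟨a⟩
    simp
  have hconj := (h.inv_schurInv hA.isUnit hB).sum_inv_mul_mul
    (Matrix.isUnit_nonsing_inv_iff.mpr hA.isUnit) (fun i j => inv_ne_zero (hB i j)) a c b
  rw [Matrix.nonsing_inv_nonsing_inv A ((Matrix.isUnit_iff_isUnit_det A).mp hA.isUnit)] at hconj
  simp only [schurInv, Matrix.map_apply, hA.inv_apply, inv_inv] at hconj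
  refine mul_left_cancel₀ (inv_ne_zero hcard) ?_
  calc (Fintype.card ι : ℂ)⁻¹ * ∑ x, A a x / (A c x * B x b)
      = ∑ x, A a x * (B x b)⁻¹ * ((Fintype.card ι : ℂ)⁻¹ * (A c x)⁻¹) := by
        rw [Finset.mul_sum]
        exact Finset.sum_congr rfl fun x _ => by ring
    _ = (Fintype.card ι : ℂ)⁻¹ * (B c b / (B a b * A c a)) := by
        rw [hconj]
        ring

theorem IsOneSidedJonesPair.sum_div_mul_self (h : IsOneSidedJonesPair A B) (hA : IsTypeII A)
    (hB : IsTypeII B) (a b c : ι) :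
    ∑ k, B c k / (B a k * B b k) = A a b / (A a c * A c b) := by
  have hcard : (Fintype.card ι : ℂ) ≠ 0 := by
    have : Nonempty ι := ⟨a⟩
    simp
  have hratio (k : ι) : B c k / B b k =
      (Fintype.card ι * A c b)⁻¹ * ∑ x, (A x c)⁻¹ * A x b * B x k := by
    have hcb := hA.ne_zero c b
    calc B c k / B b k = (A c b)⁻¹ * (B c k * A c b * (B b k)⁻¹) := by field_simp
      _ = (Fintype.card ι * A c b)⁻¹ * ∑ x, (A x c)⁻¹ * A x b * B x k := by
        rw [← h.sum_inv_mul_mul hA.isUnit hB.ne_zero, Finset.mul_sum, Finset.mul_sum]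
        refine Finset.sum_congr rfl fun x _ => ?_
        rw [hA.inv_apply]
        ring
  calc ∑ k, B c k / (B a k * B b k)
      = ∑ k, ∑ x, (Fintype.card ι * A c b)⁻¹ * ((A x c)⁻¹ * A x b) * (B x k / B a k) := by
        refine Finset.sum_congr rfl fun k _ => ?_
        rw [mul_comm (B a k), ← div_div, hratio, Finset.mul_sum, Finset.sum_div]
        exact Finset.sum_congr rfl fun x _ => by ring
    _ = ∑ x, (Fintype.card ι * A c b)⁻¹ * ((A x c)⁻¹ * A x b) * ∑ k, B x k / B a k := by
        rw [Finset.sum_comm]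
        simp only [Finset.mul_sum]
    _ = A a b / (A a c * A c b) := by
        simp only [hB.sum_div, mul_ite, mul_zero, Finset.sum_ite_eq', Finset.mem_univ, if_true]
        field_simp

end JonesPairs

section StarTriangle

variable {ι κ : Type*} [Fintype ι] [Fintype κ] {W : Matrix ι ι ℂ} {D : ℂ} {a b c : ι}

/-- The star-triangle relation of `W` with loop variable `D` at a single triple of indices. -/
def StarTriangle (W : Matrix ι ι ℂ) (D : ℂ) (a b c : ι) : Prop :=
  ∑ x, W a x * W b x / W c x = D * (W a b / (W a c * W b c))

theorem starTriangle_comm (hW : W.IsSymm) :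
    StarTriangle W D a b c ↔ StarTriangle W D b a c := by
  simp only [StarTriangle, mul_comm (W a _), hW.apply a b]

theorem starTriangle_submatrix_equiv_iff (e : κ ≃ ι) (a b c : κ) :
    StarTriangle (W.submatrix e e) D a b c ↔ StarTriangle W D (e a) (e b) (e c) := by
  simp only [StarTriangle, Matrix.submatrix_apply,
    e.sum_comp fun x => W (e a) x * W (e b) x / W (e c) x]

end StarTriangle

section BlockMatrix

variable {ι : Type*}

/-- The sign of an index of `ι ⊕ ι`: in each diagonal half of `matV d A B`, the entry at `(p, q)` is
`d * A` up to the factor `blockSign p * blockSign q`. -/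
def blockSign : ι ⊕ ι → ℂ := Sum.elim (fun _ => 1) (fun _ => -1)

/-- The row or column of `A` or `B` that an index of a half of `matV d A B` refers to. -/
def blockIndex : ι ⊕ ι → ι := Sum.elim id id

theorem blockSign_sq (p : ι ⊕ ι) : blockSign p ^ 2 = 1 := by
  cases p <;> simp [blockSign]

theorem blockSign_ne_zero (p : ι ⊕ ι) : blockSign p ≠ 0 := by
  cases p <;> simp [blockSign]

theorem blockSign_mul_eq_neg_one {p q : ι ⊕ ι} (hpq : p ≠ q) (h : blockIndex p = blockIndex q) :
    blockSign p * blockSign q = -1 := by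
  rcases p with p | p <;> rcases q with q | q <;> simp_all [blockSign, blockIndex]

theorem sum_eq_zero_of_eq_blockSign_mul [Fintype ι] {F : ι ⊕ ι → ℂ} (f : ι → ℂ)
    (hF : ∀ p, F p = blockSign p * f (blockIndex p)) : ∑ p, F p = 0 := by
  simp [hF, Fintype.sum_sum_type, blockSign, blockIndex]

theorem sum_eq_two_mul_sum_of_eq_blockIndex [Fintype ι] {F : ι ⊕ ι → ℂ} (f : ι → ℂ)
    (hF : ∀ p, F p = f (blockIndex p)) : ∑ p, F p = 2 * ∑ x, f x := by
  simp [hF, Fintype.sum_sum_type, blockIndex, two_mul]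

section Entries

variable (d : ℂ) (A B : Matrix ι ι ℂ) (p q : ι ⊕ ι)

theorem matV_inl_inl : matV d A B (.inl p) (.inl q) =
    blockSign p * blockSign q * (d * A (blockIndex p) (blockIndex q)) := by
  rcases p with p | p <;> rcases q with q | q <;> simp [matV, blockSign, blockIndex]

theorem matV_inr_inr : matV d A B (.inr p) (.inr q) =
    blockSign p * blockSign q * (d * A (blockIndex p) (blockIndex q)) := by
  rcases p with p | p <;> rcases q with q | q <;> simp [matV, blockSign, blockIndex]

theorem matV_inl_inr : matV d A B (.inl p) (.inr q) = (B (blockIndex p) (blockIndex q))⁻¹ := by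
  rcases p with p | p <;> rcases q with q | q <;> simp [matV, schurInv, blockIndex]

theorem matV_inr_inl : matV d A B (.inr p) (.inl q) = (B (blockIndex q) (blockIndex p))⁻¹ := by
  rcases p with p | p <;> rcases q with q | q <;> simp [matV, schurInv, blockIndex]

theorem matV_transpose_right : matV d A Bᵀ =
    (matV d A B).submatrix (Equiv.sumComm (ι ⊕ ι) (ι ⊕ ι)) (Equiv.sumComm (ι ⊕ ι) (ι ⊕ ι)) :=
  (Matrix.fromBlocks_submatrix_sum_swap_sum_swap _ _ _ _).symm

end Entries

variable {d : ℂ} {A B : Matrix ι ι ℂ}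

theorem matV_isSymm (hA : A.IsSymm) : (matV d A B).IsSymm := by
  have hdiag : (Matrix.fromBlocks (d • A) (-(d • A)) (-(d • A)) (d • A)).IsSymm := by
    simp [Matrix.IsSymm, Matrix.fromBlocks_transpose, hA.eq]
  exact .fromBlocks hdiag (by simp [Matrix.fromBlocks_transpose]) hdiag

theorem matV_ne_zero_iff (hd : d ≠ 0) :
    (∀ x y, matV d A B x y ≠ 0) ↔ (∀ i j, A i j ≠ 0) ∧ ∀ i j, B i j ≠ 0 := by
  simp only [matV, schurInv, Sum.forall, Matrix.fromBlocks_apply₁₁, Matrix.fromBlocks_apply₁₂,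
    Matrix.fromBlocks_apply₂₁, Matrix.fromBlocks_apply₂₂, Matrix.neg_apply, Matrix.smul_apply,
    Matrix.transpose_apply, Matrix.map_apply, smul_eq_mul, ne_eq, neg_eq_zero, inv_eq_zero,
    mul_eq_zero, hd, false_or, forall_and]
  tauto

variable [Fintype ι]

theorem sum_matV_inl_div_inl (hd : d ≠ 0) (a c : ι ⊕ ι) :
    ∑ x, matV d A B (.inl a) x / matV d A B (.inl c) x =
      2 * (blockSign a * blockSign c * ∑ x, A (blockIndex a) x / A (blockIndex c) x) +
        2 * ∑ x, B (blockIndex c) x / B (blockIndex a) x := by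
  rw [Fintype.sum_sum_type, Finset.mul_sum]
  congr 1
  · refine sum_eq_two_mul_sum_of_eq_blockIndex _ fun x => ?_
    rw [matV_inl_inl, matV_inl_inl]
    have hc := blockSign_ne_zero c
    have hx := blockSign_ne_zero x
    field_simp
    simp only [blockSign_sq, mul_one]
  · refine sum_eq_two_mul_sum_of_eq_blockIndex
      (fun x => B (blockIndex c) x / B (blockIndex a) x) fun x => ?_
    rw [matV_inl_inr, matV_inl_inr, inv_div_inv]

theorem sum_matV_inl_div_inr (a c : ι ⊕ ι) :
    ∑ x, matV d A B (.inl a) x / matV d A B (.inr c) x = 0 := by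
  rw [Fintype.sum_sum_type]
  refine (congrArg₂ (· + ·) ?_ ?_).trans (add_zero 0)
  · refine sum_eq_zero_of_eq_blockSign_mul
      (fun x => blockSign a * (d * A (blockIndex a) x) * B x (blockIndex c)) fun x => ?_
    rw [matV_inl_inl, matV_inr_inl, div_inv_eq_mul]
    ring
  · refine sum_eq_zero_of_eq_blockSign_mul
      (fun x => (B (blockIndex a) x)⁻¹ / (blockSign c * (d * A (blockIndex c) x))) fun x => ?_
    rw [matV_inl_inr, matV_inr_inr]
    have hx := blockSign_ne_zero x
    field_simp
    simp only [blockSign_sq]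

theorem sum_matV_inl_div_eq_zero [DecidableEq ι] (hd : d ≠ 0) (hA : IsTypeII A) (hB : IsTypeII B)
    {a : ι ⊕ ι} {c : (ι ⊕ ι) ⊕ (ι ⊕ ι)} (hac : .inl a ≠ c) :
    ∑ x, matV d A B (.inl a) x / matV d A B c x = 0 := by
  rcases c with c | c
  · rw [sum_matV_inl_div_inl hd, hA.sum_div, hB.sum_div]
    by_cases h : blockIndex a = blockIndex c
    · simp [h, blockSign_mul_eq_neg_one (fun hac' => hac (congrArg Sum.inl hac')) h]
    · simp [h, Ne.symm h]
  · exact sum_matV_inl_div_inr a c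

theorem isTypeII_matV [DecidableEq ι] (hd : d ≠ 0) (hA : IsTypeII A) (hB : IsTypeII B) :
    IsTypeII (matV d A B) := by
  refine isTypeII_iff_pairwise.mpr
    ⟨(matV_ne_zero_iff hd).mpr ⟨hA.ne_zero, hB.ne_zero⟩, fun a c hac => ?_⟩
  rcases a with a | a
  · exact sum_matV_inl_div_eq_zero hd hA hB hac
  · have hswap := sum_matV_inl_div_eq_zero hd hA hB.transpose (a := a) (c := c.swap)
      fun h => hac (Sum.swap_leftInverse.injective h)
    simp only [matV_transpose_right, Matrix.submatrix_apply, Equiv.sumComm_apply, Sum.swap_inl,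
      Sum.swap_swap] at hswap
    exact ((Equiv.sumComm (ι ⊕ ι) (ι ⊕ ι)).sum_comp
      fun x => matV d A B (.inr a) x / matV d A B c x).symm.trans hswap

theorem isTypeII_matV_iff [DecidableEq ι] (hd : d ≠ 0) :
    IsTypeII (matV d A B) ↔ IsTypeII A ∧ IsTypeII B := by
  refine ⟨fun hV => ?_, fun h => isTypeII_matV hd h.1 h.2⟩
  obtain ⟨hA, hB⟩ := (matV_ne_zero_iff hd).mp hV.ne_zero
  have hsums {a c : ι} (hac : a ≠ c) :
      ∑ x, A a x / A c x = 0 ∧ ∑ x, B c x / B a x = 0 := by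
    have hplus := hV.sum_div (.inl (.inl a)) (.inl (.inl c))
    have hminus := hV.sum_div (.inl (.inl a)) (.inl (.inr c))
    simp only [sum_matV_inl_div_inl hd, blockSign, blockIndex, Sum.elim_inl, Sum.elim_inr, id,
      Sum.inl.injEq, reduceCtorEq, hac, if_false] at hplus hminus
    constructor
    · linear_combination (hplus - hminus) / 4
    · linear_combination (hplus + hminus) / 4
  exact ⟨isTypeII_iff_pairwise.mpr ⟨hA, fun a c hac => (hsums hac).1⟩,
    isTypeII_iff_pairwise.mpr ⟨hB, fun a c hac => (hsums hac.symm).2⟩⟩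

theorem starTriangle_matV_swap_iff {D : ℂ} (a b c : (ι ⊕ ι) ⊕ (ι ⊕ ι)) :
    StarTriangle (matV d A B) D a.swap b.swap c.swap ↔ StarTriangle (matV d A Bᵀ) D a b c := by
  rw [matV_transpose_right]
  exact (starTriangle_submatrix_equiv_iff (Equiv.sumComm (ι ⊕ ι) (ι ⊕ ι)) a b c).symm

theorem starTriangle_matV_inl_inl_inl_iff (hd : d ≠ 0) (a b c : ι ⊕ ι) :
    StarTriangle (matV d A B) (2 * d) (.inl a) (.inl b) (.inl c) ↔
      ∑ x, B (blockIndex c) x / (B (blockIndex a) x * B (blockIndex b) x) =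
        A (blockIndex a) (blockIndex b) /
          (A (blockIndex a) (blockIndex c) * A (blockIndex b) (blockIndex c)) := by
  have ha := blockSign_ne_zero a
  have hb := blockSign_ne_zero b
  have hc := blockSign_ne_zero c
  have hleft : ∑ x, matV d A B (.inl a) (.inl x) * matV d A B (.inl b) (.inl x) /
      matV d A B (.inl c) (.inl x) = 0 := by
    refine sum_eq_zero_of_eq_blockSign_mul (fun x => blockSign a * blockSign b / blockSign c *
      (d * A (blockIndex a) x * A (blockIndex b) x / A (blockIndex c) x)) fun x => ?_
    simp only [matV_inl_inl]
    field_simp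
  have hright : ∑ x, matV d A B (.inl a) (.inr x) * matV d A B (.inl b) (.inr x) /
      matV d A B (.inl c) (.inr x) =
      2 * ∑ x, B (blockIndex c) x / (B (blockIndex a) x * B (blockIndex b) x) := by
    refine sum_eq_two_mul_sum_of_eq_blockIndex
      (fun x => B (blockIndex c) x / (B (blockIndex a) x * B (blockIndex b) x)) fun x => ?_
    rw [matV_inl_inr, matV_inl_inr, matV_inl_inr, ← mul_inv, inv_div_inv]
  have hrhs : 2 * d * (matV d A B (.inl a) (.inl b) /
      (matV d A B (.inl a) (.inl c) * matV d A B (.inl b) (.inl c))) =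
      2 * (A (blockIndex a) (blockIndex b) /
        (A (blockIndex a) (blockIndex c) * A (blockIndex b) (blockIndex c))) := by
    simp only [matV_inl_inl]
    field_simp
    simp only [blockSign_sq, mul_one]
  rw [StarTriangle, Fintype.sum_sum_type, hleft, hright, zero_add, hrhs,
    mul_right_inj' two_ne_zero]

theorem starTriangle_matV_inl_inl_inr_iff (hd : d ≠ 0) (a b c : ι ⊕ ι) :
    StarTriangle (matV d A B) (2 * d) (.inl a) (.inl b) (.inr c) ↔
      ∑ x, A (blockIndex a) x * B x (blockIndex c) * A (blockIndex b) x =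
        B (blockIndex a) (blockIndex c) * A (blockIndex a) (blockIndex b) *
          B (blockIndex b) (blockIndex c) := by
  have hleft : ∑ x, matV d A B (.inl a) (.inl x) * matV d A B (.inl b) (.inl x) /
      matV d A B (.inr c) (.inl x) = 2 * ∑ x, blockSign a * blockSign b * d ^ 2 *
        (A (blockIndex a) x * B x (blockIndex c) * A (blockIndex b) x) := by
    refine sum_eq_two_mul_sum_of_eq_blockIndex (fun x => blockSign a * blockSign b * d ^ 2 *
      (A (blockIndex a) x * B x (blockIndex c) * A (blockIndex b) x)) fun x => ?_
    rw [matV_inl_inl, matV_inl_inl, matV_inr_inl, div_inv_eq_mul]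
    linear_combination (blockSign a * blockSign b * d ^ 2 * A (blockIndex a) (blockIndex x) *
      A (blockIndex b) (blockIndex x) * B (blockIndex x) (blockIndex c)) * blockSign_sq x
  have hright : ∑ x, matV d A B (.inl a) (.inr x) * matV d A B (.inl b) (.inr x) /
      matV d A B (.inr c) (.inr x) = 0 := by
    refine sum_eq_zero_of_eq_blockSign_mul (fun x => (B (blockIndex a) x)⁻¹ *
      (B (blockIndex b) x)⁻¹ / (blockSign c * (d * A (blockIndex c) x))) fun x => ?_
    have hx := blockSign_ne_zero x
    simp only [matV_inl_inr, matV_inr_inr]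
    field_simp
    simp only [blockSign_sq]
  have hrhs : 2 * d * (matV d A B (.inl a) (.inl b) /
      (matV d A B (.inl a) (.inr c) * matV d A B (.inl b) (.inr c))) =
      2 * (blockSign a * blockSign b * d ^ 2 * (B (blockIndex a) (blockIndex c) *
        A (blockIndex a) (blockIndex b) * B (blockIndex b) (blockIndex c))) := by
    rw [matV_inl_inl, matV_inl_inr, matV_inl_inr, ← mul_inv, div_inv_eq_mul]
    ring
  have hfactor : blockSign a * blockSign b * d ^ 2 ≠ 0 := by
    simp [blockSign_ne_zero, hd]
  rw [StarTriangle, Fintype.sum_sum_type, hleft, hright, add_zero, hrhs,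
    mul_right_inj' two_ne_zero, ← Finset.mul_sum, mul_right_inj' hfactor]

theorem starTriangle_matV_inl_inr_inl_iff (hd : d ≠ 0) (a b c : ι ⊕ ι) :
    StarTriangle (matV d A B) (2 * d) (.inl a) (.inr b) (.inl c) ↔
      ∑ x, A (blockIndex a) x / (A (blockIndex c) x * B x (blockIndex b)) =
        B (blockIndex c) (blockIndex b) /
          (B (blockIndex a) (blockIndex b) * A (blockIndex a) (blockIndex c)) := by
  have ha := blockSign_ne_zero a
  have hc := blockSign_ne_zero c
  have hleft : ∑ x, matV d A B (.inl a) (.inl x) * matV d A B (.inr b) (.inl x) /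
      matV d A B (.inl c) (.inl x) = 2 * ∑ x, blockSign a * blockSign c *
        (A (blockIndex a) x / (A (blockIndex c) x * B x (blockIndex b))) := by
    refine sum_eq_two_mul_sum_of_eq_blockIndex (fun x => blockSign a * blockSign c *
      (A (blockIndex a) x / (A (blockIndex c) x * B x (blockIndex b)))) fun x => ?_
    have hx := blockSign_ne_zero x
    rw [matV_inl_inl, matV_inl_inl, matV_inr_inl]
    field_simp
    simp only [blockSign_sq, mul_one]
  have hright : ∑ x, matV d A B (.inl a) (.inr x) * matV d A B (.inr b) (.inr x) /
      matV d A B (.inl c) (.inr x) = 0 := by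
    refine sum_eq_zero_of_eq_blockSign_mul (fun x => blockSign b * ((B (blockIndex a) x)⁻¹ *
      (d * A (blockIndex b) x) * B (blockIndex c) x)) fun x => ?_
    rw [matV_inl_inr, matV_inr_inr, matV_inl_inr, div_inv_eq_mul]
    ring
  have hrhs : 2 * d * (matV d A B (.inl a) (.inr b) /
      (matV d A B (.inl a) (.inl c) * matV d A B (.inr b) (.inl c))) =
      2 * (blockSign a * blockSign c * (B (blockIndex c) (blockIndex b) /
        (B (blockIndex a) (blockIndex b) * A (blockIndex a) (blockIndex c)))) := by
    rw [matV_inl_inr, matV_inl_inl, matV_inr_inl]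
    field_simp
    simp only [blockSign_sq, one_mul]
  rw [StarTriangle, Fintype.sum_sum_type, hleft, hright, add_zero, hrhs,
    mul_right_inj' two_ne_zero, ← Finset.mul_sum, mul_right_inj' (mul_ne_zero ha hc)]

theorem isOneSidedJonesPair_iff_starTriangle (hd : d ≠ 0) (hA : A.IsSymm) :
    IsOneSidedJonesPair A B ↔
      ∀ a b c, StarTriangle (matV d A B) (2 * d) (.inl a) (.inl b) (.inr c) := by
  simp only [starTriangle_matV_inl_inl_inr_iff hd, isOneSidedJonesPair_iff]
  have hsum (i j k : ι) : ∑ x, A i x * B x k * A x j = ∑ x, A i x * B x k * A j x :=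
    Finset.sum_congr rfl fun x _ => by rw [hA.apply j x]
  simp only [hsum]
  exact ⟨fun h a b c => h _ _ _, fun h i j k => h (.inl i) (.inl j) (.inl k)⟩

theorem isJonesPair_of_starTriangle (hd : d ≠ 0) (hA : A.IsSymm)
    (h : ∀ a b c, StarTriangle (matV d A B) (2 * d) a b c) : IsJonesPair A B :=
  ⟨(isOneSidedJonesPair_iff_starTriangle hd hA).mpr fun _ _ _ => h _ _ _,
    (isOneSidedJonesPair_iff_starTriangle hd hA).mpr fun _ _ _ =>
      (starTriangle_matV_swap_iff _ _ _).mp (h _ _ _)⟩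

variable [DecidableEq ι]

theorem starTriangle_matV_inl_inl (hd : d ≠ 0) (hAsymm : A.IsSymm) (hA : IsTypeII A)
    (hB : IsTypeII B) (h : IsOneSidedJonesPair A B) (a b : ι ⊕ ι) (c : (ι ⊕ ι) ⊕ (ι ⊕ ι)) :
    StarTriangle (matV d A B) (2 * d) (.inl a) (.inl b) c := by
  rcases c with c | c
  · rw [starTriangle_matV_inl_inl_inl_iff hd, h.sum_div_mul_self hA hB,
      hAsymm.apply (blockIndex b) (blockIndex c)]
  · exact (isOneSidedJonesPair_iff_starTriangle hd hAsymm).mp h a b c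

theorem starTriangle_matV_inl_inr_inl (hd : d ≠ 0) (hAsymm : A.IsSymm) (hA : IsTypeII A)
    (hB : ∀ i j, B i j ≠ 0) (h : IsOneSidedJonesPair A B) (a b c : ι ⊕ ι) :
    StarTriangle (matV d A B) (2 * d) (.inl a) (.inr b) (.inl c) := by
  rw [starTriangle_matV_inl_inr_inl_iff hd, h.sum_div_mul hA hB, hAsymm.apply]

theorem starTriangle_matV (hd : d ≠ 0) (hAsymm : A.IsSymm) (hA : IsTypeII A) (hB : IsTypeII B)
    (h : IsJonesPair A B) (a b c : (ι ⊕ ι) ⊕ (ι ⊕ ι)) :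
    StarTriangle (matV d A B) (2 * d) a b c := by
  have hcomm {x y z} := starTriangle_comm (D := 2 * d) (a := x) (b := y) (c := z)
    (matV_isSymm (d := d) (B := B) hAsymm)
  have hmixed (p q : ι ⊕ ι) (z : (ι ⊕ ι) ⊕ (ι ⊕ ι)) :
      StarTriangle (matV d A B) (2 * d) (.inl p) (.inr q) z := by
    rcases z with r | r
    · exact starTriangle_matV_inl_inr_inl hd hAsymm hA hB.ne_zero h.1 p q r
    · exact hcomm.mp <| (starTriangle_matV_swap_iff (.inl q) (.inr p) (.inl r)).mpr <|
        starTriangle_matV_inl_inr_inl hd hAsymm hA hB.transpose.ne_zero h.2 q p r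
  rcases a with a | a <;> rcases b with b | b
  · exact starTriangle_matV_inl_inl hd hAsymm hA hB h.1 a b c
  · exact hmixed a b c
  · exact hcomm.mp (hmixed b a c)
  · rw [← c.swap_swap]
    exact (starTriangle_matV_swap_iff (.inl a) (.inl b) c.swap).mpr <|
      starTriangle_matV_inl_inl hd hAsymm hA hB.transpose h.2 a b c.swap

end BlockMatrix

end JonesPairs

theorem mainTheorem2_general {ι : Type*} [Fintype ι] [DecidableEq ι] (d : ℂ)
    (hd : d ^ 2 = (Fintype.card ι : ℂ)) (A B : Matrix ι ι ℂ)
    (hA : ∀ i j, A i j ≠ 0) (hB : ∀ i j, B i j ≠ 0) (hAsymm : A.IsSymm) :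
    JonesPairs.IsSymmetricSpinModel (JonesPairs.matV d A B) (2 * d) ↔
      JonesPairs.IsInvertibleJonesPair A B := by
  have hloop : (2 * d) ^ 2 = (Fintype.card ((ι ⊕ ι) ⊕ (ι ⊕ ι)) : ℂ) := by
    simp only [Fintype.card_sum, Nat.cast_add]
    linear_combination 4 * hd
  rcases eq_or_ne d 0 with rfl | hd0
  · have : IsEmpty ι := Fintype.card_eq_zero_iff.mp (by simpa [eq_comm] using hd)
    exact iff_of_true
      ⟨JonesPairs.matV_isSymm hAsymm, hloop, ⟨isEmptyElim, Subsingleton.elim _ _⟩, isEmptyElim⟩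
      ⟨⟨Subsingleton.elim _ _, Subsingleton.elim _ _⟩, isUnit_of_subsingleton _,
        isUnit_of_subsingleton _⟩
  refine ⟨fun hV => ?_, fun ⟨hJones, hX, _⟩ => ?_⟩
  · have hAII : JonesPairs.IsTypeII A := ((JonesPairs.isTypeII_matV_iff hd0).mp hV.typeII).1
    exact ⟨JonesPairs.isJonesPair_of_starTriangle hd0 hAsymm hV.star_triangle,
      JonesPairs.isUnit_opX_iff.mpr hAII.isUnit, (JonesPairs.opDeltaUnit B hB).isUnit⟩
  · have hAunit : IsUnit A := JonesPairs.isUnit_opX_iff.mp hX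
    have hBII := hJones.isTypeII_right hAunit (fun i j _ => hA i j) hB
    have hAII := hJones.isTypeII_left hAunit hBII
    exact ⟨JonesPairs.matV_isSymm hAsymm, hloop, JonesPairs.isTypeII_matV hd0 hAII hBII,
      JonesPairs.starTriangle_matV hd0 hAsymm hAII hBII hJones⟩

theorem mainTheorem2 (n : ℕ) (d : ℂ) (hd : d ^ 2 = (n : ℂ))
    (A B : Matrix (Fin n) (Fin n) ℂ)
    (hA : JonesPairs.IsTypeII A) (hB : JonesPairs.IsTypeII B) (hAsymm : A.IsSymm) :
    JonesPairs.IsSymmetricSpinModel (JonesPairs.matV d A B) (2 * d) ↔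
      JonesPairs.IsInvertibleJonesPair A B :=
  mainTheorem2_general d (by simpa using hd) A B hA.ne_zero hB.ne_zero hAsymm
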